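/- Let $d\ge 2$, let $\Omega\subset\mathbb{R}^d$ be a bounded, simply connected Lipschitz domain, and let $\mathcal{T}$ be a finite mesh of $\Omega$: a finite family of pairwise disjoint Lipschitz domains $T\subset\Omega$ with $\overline\Omega=\bigcup_{T\in\mathcal{T}}\overline T$. Let $\mathcal{S}=\{\partial T : T\in\mathcal{T}\}$ be its skeleton. For an open set $\omega$ let $$H(\nabla\mathrm{div},\omega)=\{v\in L_2(\omega)^d : \nabla\,\mathrm{div}\,v\in L_2(\omega)^d\},\qquad \|v\|_{\nabla\mathrm{div},\omega}^2=\|v\|_{L_2(\omega)}^2+\|\nabla\,\mathrm{div}\,v\|_{L_2(\omega)}^2,$$ with $\nabla\,\mathrm{div}$ in the sense of distributions, and let $H(\nabla\mathrm{div},\mathcal{T})=\prod_{T\in\mathcal{T}}H(\nabla\mathrm{div},T)$ with the product norm $\|v\|_{\nabla\mathrm{div},\mathcal{T}}^2=\sum_{T}\|v|_T\|_{\nabla\mathrm{div},T}^2$. Define the trace operator $\mathrm{tr}:H(\nabla\mathrm{div},\mathcal{T})\to H(\nabla\mathrm{div},\mathcal{T})'$ by $$\langle \mathrm{tr}(v),\tau\rangle_{\mathcal{S}}=\sum_{T\in\mathcal{T}}\Big(\int_T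 v\cdot\nabla\,\mathrm{div}\,\tau-\int_T\nabla\,\mathrm{div}\,v\cdot\tau\Big),$$ and let $H^{-1/2,1/2}(\mathcal{S})=\mathrm{tr}(H(\nabla\mathrm{div},\Omega))$, where $v\in H(\nabla\mathrm{div},\Omega)$ is identified with $(v|_T)_{T\in\mathcal{T}}\in H(\nabla\mathrm{div},\mathcal{T})$. Then, for every $\hat v\in H^{-1/2,1/2}(\mathcal{S})$, the norms $$\|\hat v\|_{-1/2,1/2,\mathcal{S}}:=\inf\{\|v\|_{\nabla\mathrm{div},\Omega} : v\in H(\nabla\mathrm{div},\Omega),\ \mathrm{tr}(v)=\hat v\},\qquad \|\hat v\|_{(\nabla\mathrm{div},\mathcal{T})'}:=\sup\{\langle\hat v,\tau\rangle_{\mathcal{S}} : \tau\in H(\nabla\mathrm{div},\mathcal{T}),\ \|\tau\|_{\nabla\mathrm{div},\mathcal{T}}=1\}$$ coincide: $$\|\hat v\|_{-1/2,1/2,\mathcal{S}}=\|\hat v\|_{(\nabla\mathrm{div},\mathcal{T})'}.$$ -/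

import Mathlib

open MeasureTheory TopologicalSpace
open scoped ContDiff RealInnerProductSpace

noncomputable section

/-- The Euclidean space `ℝ^d`. -/
abbrev Rd (d : ℕ) : Type := EuclideanSpace ℝ (Fin d)

/-- A Lipschitz domain: a (non-empty) connected open set which, near each of its boundary points,
is the set of points lying strictly above the graph of a Lipschitz function, for a suitable choice
of the vertical direction `e` (the function lives on the hyperplane orthogonal to `e`). -/
structure IsLipschitzDomain {d : ℕ} (D : Opens (Rd d)) : Prop where
  connected : IsConnected (D : Set (Rd d))
  boundary : ∀ x ∈ frontier (D : Set (Rd d)),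
    ∃ e : Rd d, ‖e‖ = 1 ∧ ∃ (K : NNReal) (g : (Submodule.span ℝ {e})ᗮ → ℝ),
      LipschitzWith K g ∧ ∃ U ∈ nhds x,
        (D : Set (Rd d)) ∩ U =
          {y ∈ U | g ((Submodule.span ℝ {e})ᗮ.orthogonalProjectionOnto y) < ⟪e, y⟫}

/-- A mesh of `Ω`: finitely many pairwise disjoint Lipschitz elements contained in `Ω`,
whose closures cover the closure of `Ω`. -/
structure IsLipschitzMesh {d : ℕ} {ι : Type*} [Fintype ι] (Ω : Opens (Rd d))
    (T : ι → Opens (Rd d)) : Prop where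
  lipschitz : ∀ i, IsLipschitzDomain (T i)
  le : ∀ i, T i ≤ Ω
  disjoint : Pairwise fun i j => Disjoint (T i : Set (Rd d)) (T j : Set (Rd d))
  cover : closure (Ω : Set (Rd d)) = ⋃ i, closure (T i : Set (Rd d))

/-- The space `L₂(D)^d` of square integrable vector fields on `D`. -/
abbrev L2Field {d : ℕ} (D : Opens (Rd d)) : Type :=
  Lp (Rd d) 2 (volume.restrict (D : Set (Rd d)))

/-- The classical divergence of a vector field. -/
def classicalDiv {d : ℕ} (φ : Rd d → Rd d) (x : Rd d) : ℝ :=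
  ∑ i, fderiv ℝ φ x (EuclideanSpace.single i 1) i

/-- The classical `∇ div` of a vector field. -/
def classicalGradDiv {d : ℕ} (φ : Rd d → Rd d) : Rd d → Rd d :=
  gradient (classicalDiv φ)

/-- Test fields on `D`, that is, elements of `C₀^∞(D)^d`. -/
structure IsTestField {d : ℕ} (D : Opens (Rd d)) (φ : Rd d → Rd d) : Prop where
  smooth : ContDiff ℝ ∞ φ
  compact : HasCompactSupport φ
  supp : tsupport φ ⊆ (D : Set (Rd d))

/-- `∇ div v = g` on `D` in the sense of distributions. -/
def HasWeakGradDiv {d : ℕ} (D : Opens (Rd d)) (v g : L2Field D) : Prop :=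
  ∀ φ : Rd d → Rd d, IsTestField D φ →
    ∫ x in (D : Set (Rd d)), ⟪v x, classicalGradDiv φ x⟫ =
      ∫ x in (D : Set (Rd d)), ⟪g x, φ x⟫

theorem contDiff_classicalDiv {d : ℕ} {φ : Rd d → Rd d} (h : ContDiff ℝ ∞ φ) :
    ContDiff ℝ ∞ (classicalDiv φ) := by
  have h1 : ContDiff ℝ ∞ (fderiv ℝ φ) := h.fderiv_right (by simp)
  unfold classicalDiv
  refine ContDiff.sum fun i _ => ?_
  exact (contDiff_euclidean.1 (h1.clm_apply contDiff_const)) i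

theorem continuous_classicalGradDiv {d : ℕ} {φ : Rd d → Rd d} (h : ContDiff ℝ ∞ φ) :
    Continuous (classicalGradDiv φ) := by
  have h1 : Continuous (fderiv ℝ (classicalDiv φ)) :=
    (contDiff_classicalDiv h).continuous_fderiv (by simp)
  exact (InnerProductSpace.toDual ℝ (Rd d)).symm.continuous.comp h1

theorem support_classicalGradDiv {d : ℕ} (φ : Rd d → Rd d) :
    Function.support (classicalGradDiv φ) ⊆ tsupport φ := by
  have h1 : Function.support (classicalDiv φ) ⊆ tsupport φ := by
    intro x hx
    by_contra hxt
    apply hx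
    have h0 : fderiv ℝ φ x = 0 := by
      have := mt (fun h => support_fderiv_subset ℝ (f := φ) h) hxt
      simpa using this
    simp [classicalDiv, h0]
  intro x hx
  have hx' : x ∈ Function.support (fderiv ℝ (classicalDiv φ)) := by
    intro h0
    apply hx
    simp [classicalGradDiv, gradient, h0]
  exact closure_minimal h1 (isClosed_tsupport φ) (support_fderiv_subset ℝ hx')

theorem hasCompactSupport_classicalGradDiv {d : ℕ} {φ : Rd d → Rd d} (h : HasCompactSupport φ) :
    HasCompactSupport (classicalGradDiv φ) :=
  h.mono' (support_classicalGradDiv φ)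

theorem integrable_inner_of_compactSupport {d : ℕ} {D : Opens (Rd d)} (v : L2Field D)
    {ψ : Rd d → Rd d} (hc : Continuous ψ) (hs : HasCompactSupport ψ) :
    Integrable (fun x => ⟪v x, ψ x⟫) (volume.restrict (D : Set (Rd d))) :=
  by
    have hm : MemLp ψ 2 (volume.restrict (D : Set (Rd d))) := hc.memLp_of_hasCompactSupport hs
    refine (L2.integrable_inner (𝕜 := ℝ) v hm.toLp).congr ?_
    filter_upwards [hm.coeFn_toLp] with x hx
    rw [hx]

theorem HasWeakGradDiv.add {d : ℕ} {D : Opens (Rd d)} {v g w k : L2Field D}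
    (h1 : HasWeakGradDiv D v g) (h2 : HasWeakGradDiv D w k) :
    HasWeakGradDiv D (v + w) (g + k) := by
  intro φ hφ
  have e1 : ∀ (a b : L2Field D) (ψ : Rd d → Rd d), Continuous ψ → HasCompactSupport ψ →
      ∫ x in (D : Set (Rd d)), ⟪(a + b) x, ψ x⟫ =
        (∫ x in (D : Set (Rd d)), ⟪a x, ψ x⟫) + ∫ x in (D : Set (Rd d)), ⟪b x, ψ x⟫ := by
    intro a b ψ hc hs
    rw [← integral_add (integrable_inner_of_compactSupport a hc hs)
      (integrable_inner_of_compactSupport b hc hs)]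
    refine integral_congr_ae ?_
    filter_upwards [Lp.coeFn_add a b] with x hx
    rw [hx, Pi.add_apply, inner_add_left]
  rw [e1 _ _ _ (continuous_classicalGradDiv hφ.smooth)
    (hasCompactSupport_classicalGradDiv hφ.compact),
    e1 _ _ _ hφ.smooth.continuous hφ.compact, h1 φ hφ, h2 φ hφ]

theorem HasWeakGradDiv.smul {d : ℕ} {D : Opens (Rd d)} {v g : L2Field D} (c : ℝ)
    (h1 : HasWeakGradDiv D v g) : HasWeakGradDiv D (c • v) (c • g) := by
  intro φ hφ
  have e1 : ∀ (a : L2Field D) (ψ : Rd d → Rd d),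
      ∫ x in (D : Set (Rd d)), ⟪(c • a) x, ψ x⟫ =
        c * ∫ x in (D : Set (Rd d)), ⟪a x, ψ x⟫ := by
    intro a ψ
    rw [← integral_const_mul]
    refine integral_congr_ae ?_
    filter_upwards [Lp.coeFn_smul c a] with x hx
    rw [hx, Pi.smul_apply, real_inner_smul_left]
  rw [e1, e1, h1 φ hφ]

theorem HasWeakGradDiv.zero {d : ℕ} (D : Opens (Rd d)) :
    HasWeakGradDiv D (0 : L2Field D) 0 := by
  have e1 : ∀ (ψ : Rd d → Rd d),
      ∫ x in (D : Set (Rd d)), ⟪(0 : L2Field D) x, ψ x⟫ = 0 := by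
    intro ψ
    refine integral_eq_zero_of_ae ?_
    filter_upwards [Lp.coeFn_zero (Rd d) 2 (volume.restrict (D : Set (Rd d)))] with x hx
    rw [hx]; simp
  intro φ _
  rw [e1, e1]

/-- The weak `∇ div` is unique. -/
theorem HasWeakGradDiv.unique {d : ℕ} {D : Opens (Rd d)} {v g k : L2Field D}
    (h1 : HasWeakGradDiv D v g) (h2 : HasWeakGradDiv D v k) : g = k := by
  have hI : ∀ a : L2Field D, LocallyIntegrableOn a (D : Set (Rd d)) volume := fun a =>
    locallyIntegrableOn_of_locallyIntegrable_restrict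
      ((Lp.memLp a).locallyIntegrable (by norm_num))
  have key := D.isOpen.ae_eq_zero_of_integral_contDiff_smul_eq_zero
    (f := fun x => g x - k x) (μ := volume) ((hI g).sub (hI k)) ?_
  · refine Lp.ext ?_
    rw [Filter.EventuallyEq, ae_restrict_iff' D.isOpen.measurableSet]
    filter_upwards [key] with x hx hxD
    exact sub_eq_zero.1 (hx hxD)
  · intro ψ hψ hψc hψs
    have hint : ∀ a : L2Field D,
        Integrable (fun x => ψ x • a x) (volume.restrict (D : Set (Rd d))) := by
      intro a
      have hm : MemLp ψ 2 (volume.restrict (D : Set (Rd d))) :=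
        hψ.continuous.memLp_of_hasCompactSupport hψc
      exact memLp_one_iff_integrable.1 ((Lp.memLp a).smul hm)
    have hset : ∫ x, ψ x • (g x - k x) = ∫ x in (D : Set (Rd d)), ψ x • (g x - k x) := by
      symm
      refine setIntegral_eq_integral_of_forall_compl_eq_zero fun x hx => ?_
      have : ψ x = 0 := image_eq_zero_of_notMem_tsupport fun h => hx (hψs h)
      simp [this]
    rw [hset]
    have hsub : ∫ x in (D : Set (Rd d)), ψ x • (g x - k x) =
        (∫ x in (D : Set (Rd d)), ψ x • g x) - ∫ x in (D : Set (Rd d)), ψ x • k x := by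
      rw [← integral_sub (hint g) (hint k)]
      simp only [smul_sub]
    rw [hsub, sub_eq_zero]
    refine ext_inner_left ℝ fun c => ?_
    rw [← integral_inner (hint g), ← integral_inner (hint k)]
    have ht : IsTestField D (fun x => ψ x • c) := by
      refine ⟨hψ.smul contDiff_const, hψc.smul_right, ?_⟩
      exact (tsupport_smul_subset_left ψ (fun _ => c)).trans hψs
    have := (h1 _ ht).symm.trans (h2 _ ht)
    simpa only [inner_smul_right, real_inner_comm] using this

/-- The fields in `L₂(D)^d` whose distributional `∇ div` lies in `L₂(D)^d`. -/
def hGradDivSubmodule {d : ℕ} (D : Opens (Rd d)) : Submodule ℝ (L2Field D) where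
  carrier := {v | ∃ g : L2Field D, HasWeakGradDiv D v g}
  add_mem' := fun ⟨g, hg⟩ ⟨k, hk⟩ => ⟨g + k, hg.add hk⟩
  zero_mem' := ⟨0, HasWeakGradDiv.zero D⟩
  smul_mem' := fun c _ ⟨g, hg⟩ => ⟨c • g, hg.smul c⟩

/-- The space `H(∇div, D)`. It is a copy of `hGradDivSubmodule D`, so that it can carry the graph
norm instead of the `L₂` norm. -/
def HGradDiv {d : ℕ} (D : Opens (Rd d)) : Type := hGradDivSubmodule D

instance {d : ℕ} (D : Opens (Rd d)) : AddCommGroup (HGradDiv D) :=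
  inferInstanceAs (AddCommGroup (hGradDivSubmodule D))

instance {d : ℕ} (D : Opens (Rd d)) : Module ℝ (HGradDiv D) :=
  inferInstanceAs (Module ℝ (hGradDivSubmodule D))

namespace HGradDiv

/-- The inclusion of `H(∇div, D)` in `L₂(D)^d`. -/
def field {d : ℕ} (D : Opens (Rd d)) : HGradDiv D →ₗ[ℝ] L2Field D :=
  (hGradDivSubmodule D).subtype

/-- The operator `∇div : H(∇div, D) → L₂(D)^d`. -/
def gradDiv {d : ℕ} (D : Opens (Rd d)) : HGradDiv D →ₗ[ℝ] L2Field D where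
  toFun v := Classical.choose v.2
  map_add' v w := (Classical.choose_spec (v + w).2).unique
    ((Classical.choose_spec v.2).add (Classical.choose_spec w.2))
  map_smul' c v := (Classical.choose_spec (c • v).2).unique
    ((Classical.choose_spec v.2).smul c)

theorem hasWeakGradDiv {d : ℕ} {D : Opens (Rd d)} (v : HGradDiv D) :
    HasWeakGradDiv D (field D v) (gradDiv D v) :=
  Classical.choose_spec v.2

theorem field_injective {d : ℕ} (D : Opens (Rd d)) : Function.Injective (field D) :=
  Subtype.val_injective

/-- The graph inner product `(v, w)_D + (∇div v, ∇div w)_D` on `H(∇div, D)`. -/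
@[reducible] def innerCore {d : ℕ} (D : Opens (Rd d)) : InnerProductSpace.Core ℝ (HGradDiv D) where
  inner v w := ⟪field D v, field D w⟫ + ⟪gradDiv D v, gradDiv D w⟫
  conj_inner_symm v w := by
    simp [real_inner_comm]
  re_inner_nonneg v := by
    simpa using add_nonneg (real_inner_self_nonneg (x := field D v))
      (real_inner_self_nonneg (x := gradDiv D v))
  add_left u v w := by
    simp only [map_add, inner_add_left]; ring
  smul_left v w c := by
    simp only [map_smul, real_inner_smul_left, conj_trivial]; ring
  definite v hv := by
    have h1 := real_inner_self_nonneg (x := field D v)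
    have h2 := real_inner_self_nonneg (x := gradDiv D v)
    have h0 : ⟪field D v, field D v⟫ = 0 := by linarith
    exact field_injective D ((inner_self_eq_zero.1 h0).trans (map_zero (field D)).symm)

instance {d : ℕ} (D : Opens (Rd d)) : NormedAddCommGroup (HGradDiv D) :=
  (innerCore D).toNormedAddCommGroup

instance {d : ℕ} (D : Opens (Rd d)) : InnerProductSpace ℝ (HGradDiv D) :=
  InnerProductSpace.ofCore (innerCore D).toCore

/-- The norm of `H(∇div, D)` is the graph norm. -/
theorem norm_sq {d : ℕ} {D : Opens (Rd d)} (v : HGradDiv D) :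
    ‖v‖ ^ 2 = ‖field D v‖ ^ 2 + ‖gradDiv D v‖ ^ 2 := by
  rw [← real_inner_self_eq_norm_sq, ← real_inner_self_eq_norm_sq (field D v),
    ← real_inner_self_eq_norm_sq (gradDiv D v)]
  rfl

/-- The inclusion of `H(∇div, D)` in `L₂(D)^d` as a bounded operator. -/
def fieldL {d : ℕ} (D : Opens (Rd d)) : HGradDiv D →L[ℝ] L2Field D :=
  (field D).mkContinuous 1 fun v => by
    rw [one_mul]
    refine abs_le_of_sq_le_sq' ?_ (norm_nonneg v) |>.2
    rw [norm_sq]; nlinarith [sq_nonneg ‖gradDiv D v‖]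

/-- The operator `∇div : H(∇div, D) → L₂(D)^d` as a bounded operator. -/
def gradDivL {d : ℕ} (D : Opens (Rd d)) : HGradDiv D →L[ℝ] L2Field D :=
  (gradDiv D).mkContinuous 1 fun v => by
    rw [one_mul]
    refine abs_le_of_sq_le_sq' ?_ (norm_nonneg v) |>.2
    rw [norm_sq]; nlinarith [sq_nonneg ‖field D v‖]

end HGradDiv

/-- Restriction `v ↦ v|_D'` of square integrable fields from `D` to a smaller open set `D'`. -/
def restrictL2 {d : ℕ} {D' D : Opens (Rd d)} (h : D' ≤ D) : L2Field D →ₗ[ℝ] L2Field D' where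
  toFun v := ((Lp.memLp v).mono_measure (Measure.restrict_mono h le_rfl)).toLp v
  map_add' v w := by
    rw [← MemLp.toLp_add]
    refine (MemLp.toLp_eq_toLp_iff _ _).2 ?_
    exact ae_mono (Measure.restrict_mono h le_rfl) (Lp.coeFn_add v w)
  map_smul' c v := by
    rw [RingHom.id_apply, ← MemLp.toLp_const_smul]
    refine (MemLp.toLp_eq_toLp_iff _ _).2 ?_
    exact ae_mono (Measure.restrict_mono h le_rfl) (Lp.coeFn_smul c v)

theorem restrictL2_coeFn {d : ℕ} {D' D : Opens (Rd d)} (h : D' ≤ D) (v : L2Field D) :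
    restrictL2 h v =ᵐ[volume.restrict (D' : Set (Rd d))] v :=
  MemLp.coeFn_toLp ((Lp.memLp v).mono_measure (Measure.restrict_mono h le_rfl))

theorem HasWeakGradDiv.restrict {d : ℕ} {D' D : Opens (Rd d)} (h : D' ≤ D) {v g : L2Field D}
    (hv : HasWeakGradDiv D v g) : HasWeakGradDiv D' (restrictL2 h v) (restrictL2 h g) := by
  have e1 : ∀ (a : L2Field D) (ψ : Rd d → Rd d),
      Function.support ψ ⊆ (D' : Set (Rd d)) →
      ∫ x in (D' : Set (Rd d)), ⟪restrictL2 h a x, ψ x⟫ =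
        ∫ x in (D : Set (Rd d)), ⟪a x, ψ x⟫ := by
    intro a ψ hψ
    have hz : ∀ x, x ∉ (D' : Set (Rd d)) → ⟪a x, ψ x⟫ = 0 := by
      intro x hx
      have : ψ x = 0 := by
        by_contra h0
        exact hx (hψ h0)
      rw [this, inner_zero_right]
    calc ∫ x in (D' : Set (Rd d)), ⟪restrictL2 h a x, ψ x⟫
        = ∫ x in (D' : Set (Rd d)), ⟪a x, ψ x⟫ := by
          refine integral_congr_ae ?_
          filter_upwards [restrictL2_coeFn h a] with x hx
          rw [hx]
      _ = ∫ x, ⟪a x, ψ x⟫ :=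
          setIntegral_eq_integral_of_forall_compl_eq_zero hz
      _ = ∫ x in (D : Set (Rd d)), ⟪a x, ψ x⟫ :=
          (setIntegral_eq_integral_of_forall_compl_eq_zero
            fun x hx => hz x fun hx' => hx (h hx')).symm
  intro φ hφ
  rw [e1 _ _ ((support_classicalGradDiv φ).trans hφ.supp),
    e1 _ _ ((subset_tsupport φ).trans hφ.supp)]
  exact hv φ ⟨hφ.smooth, hφ.compact, hφ.supp.trans h⟩

/-- Restriction `v ↦ v|_D'` from `H(∇div, D)` to `H(∇div, D')`. -/
def HGradDiv.restrict {d : ℕ} {D' D : Opens (Rd d)} (h : D' ≤ D) :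
    HGradDiv D →ₗ[ℝ] HGradDiv D' :=
  ((restrictL2 h).comp (HGradDiv.field D)).codRestrict (hGradDivSubmodule D')
    fun v => ⟨_, v.hasWeakGradDiv.restrict h⟩

/-- The broken space `H(∇div, 𝒯) = ∏ H(∇div, T)` with the canonical product norm
`(∑ ‖v_T‖²)^{1/2}`. -/
abbrev BrokenHGradDiv {d : ℕ} {ι : Type*} [Fintype ι] (T : ι → Opens (Rd d)) : Type _ :=
  PiLp 2 fun i => HGradDiv (T i)

/-- The embedding `H(∇div, Ω) → H(∇div, 𝒯)`, `v ↦ (v|_T)_T`. -/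
def toBroken {d : ℕ} {ι : Type*} [Fintype ι] {Ω : Opens (Rd d)} {T : ι → Opens (Rd d)}
    (h : ∀ i, T i ≤ Ω) : HGradDiv Ω →ₗ[ℝ] BrokenHGradDiv T :=
  (WithLp.linearEquiv 2 ℝ (∀ i, HGradDiv (T i))).symm.toLinearMap.comp
    (LinearMap.pi fun i => HGradDiv.restrict (h i))

/-- The trace operator `H(∇div, 𝒯) → H(∇div, 𝒯)'`,
`⟨tr v, τ⟩ = (v, ∇div τ)_𝒯 - (∇div v, τ)_𝒯`. -/
def gradDivTrace {d : ℕ} {ι : Type*} [Fintype ι] (T : ι → Opens (Rd d)) :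
    BrokenHGradDiv T →L[ℝ] StrongDual ℝ (BrokenHGradDiv T) :=
  ∑ i,
    ((innerSL ℝ).bilinearComp ((HGradDiv.fieldL (T i)).comp (PiLp.proj 2 _ i))
        ((HGradDiv.gradDivL (T i)).comp (PiLp.proj 2 _ i)) -
      (innerSL ℝ).bilinearComp ((HGradDiv.gradDivL (T i)).comp (PiLp.proj 2 _ i))
        ((HGradDiv.fieldL (T i)).comp (PiLp.proj 2 _ i)))

theorem gradDivTrace_apply {d : ℕ} {ι : Type*} [Fintype ι] (T : ι → Opens (Rd d))
    (v τ : BrokenHGradDiv T) :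
    gradDivTrace T v τ =
      ∑ i, (⟪HGradDiv.field (T i) (v i), HGradDiv.gradDiv (T i) (τ i)⟫ -
        ⟪HGradDiv.gradDiv (T i) (v i), HGradDiv.field (T i) (τ i)⟫) := by
  simp [gradDivTrace, HGradDiv.fieldL, HGradDiv.gradDivL]

/-- The trace space `H^{-1/2,1/2}(𝒮) = tr(H(∇div, Ω))` on the skeleton. -/
def skeletonTraceSpace {d : ℕ} {ι : Type*} [Fintype ι] {Ω : Opens (Rd d)}
    {T : ι → Opens (Rd d)} (h : ∀ i, T i ≤ Ω) : Submodule ℝ (StrongDual ℝ (BrokenHGradDiv T)) :=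
  LinearMap.range ((gradDivTrace T).toLinearMap.comp (toBroken h))

/-- The minimal extension norm
`‖v̂‖_{-1/2,1/2,𝒮} = inf {‖v‖_{∇div} ; v ∈ H(∇div, Ω), tr v = v̂}`. -/
def minimalExtensionNorm {d : ℕ} {ι : Type*} [Fintype ι] {Ω : Opens (Rd d)}
    {T : ι → Opens (Rd d)} (h : ∀ i, T i ≤ Ω) (vhat : skeletonTraceSpace h) : ℝ :=
  sInf {r : ℝ | ∃ v : HGradDiv Ω, gradDivTrace T (toBroken h v) = vhat.1 ∧ r = ‖v‖}

/-- The dual norm `‖v̂‖_{(∇div,𝒯)'} = sup {⟨v̂, τ⟩ ; τ ∈ H(∇div, 𝒯), ‖τ‖_{∇div,𝒯} = 1}`. -/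
def dualTraceNorm {d : ℕ} {ι : Type*} [Fintype ι] {Ω : Opens (Rd d)}
    {T : ι → Opens (Rd d)} (h : ∀ i, T i ≤ Ω) (vhat : skeletonTraceSpace h) : ℝ :=
  sSup {r : ℝ | ∃ τ : BrokenHGradDiv T, ‖τ‖ = 1 ∧ r = vhat.1 τ}

end

/-! Let `τ` be the Riesz representative of `v̂` in the broken space, so that the dual norm of `v̂`
is `‖τ‖`. Since `v̂` is the trace of some `w`, it vanishes on fields compactly supported in one
element, which gives `∇div ∇div τ = -τ` there. Put `v = ∇div τ` elementwise, so `∇div v = -τ`. Then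
`v` has the same norm as `τ`, and its trace is `δ ↦ (∇div τ, ∇div δ) + (τ, δ) = v̂(δ)`. If `u` is
any extension of `v̂`, then `‖τ‖² = v̂(τ) = (u, v) ≤ ‖u‖ ‖τ‖`, so `v` is minimal once it is known to
lie in `H(∇div, Ω)`.

That last point is `exists_toBroken_eq`: a broken field is conforming as soon as its trace
annihilates test fields on `Ω`, a property that `v` inherits from `w`. Passing between `Ω` and the
elements requires the skeleton to be a null set (`IsLipschitzMesh.ae_eq_iUnion`), and the Riesz
representative requires `H(∇div, D)` to be complete. -/

/-! ### Null skeleton and the splitting of `L₂(Ω)` over the mesh. -/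

/-- The graph `{y | g (P y) = ⟪e, y⟫}` of a continuous function over the hyperplane orthogonal to
a unit vector `e` is a null set. -/
theorem volume_graph_eq_zero {d : ℕ} {e : Rd d} (he : ‖e‖ = 1)
    {g : (Submodule.span ℝ {e})ᗮ → ℝ} (hg : Continuous g) :
    volume {y : Rd d | g ((Submodule.span ℝ {e})ᗮ.orthogonalProjectionOnto y) = ⟪e, y⟫} = 0 := by
  have hee : ⟪e, e⟫ = (1 : ℝ) := by rw [real_inner_self_eq_norm_sq, he, one_pow]
  have hPe : (Submodule.span ℝ {e})ᗮ.orthogonalProjectionOnto e = 0 :=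
    Submodule.orthogonalProjectionOnto_orthogonal_apply_eq_zero
      (Submodule.mem_span_singleton_self e)
  -- Moving along `e` changes the height but not the projection, so distinct multiples of `e` give
  -- disjoint translates of the graph. Infinitely many disjoint translates by a bounded sequence
  -- force measure zero.
  refine Measure.addHaar_eq_zero_of_disjoint_translates volume
    (fun n : ℕ => ((n : ℝ) + 1)⁻¹ • e) ?_ ?_ ?_
  · refine (Metric.isBounded_closedBall (x := (0 : Rd d)) (r := 1)).subset ?_
    rintro _ ⟨n, rfl⟩
    rw [mem_closedBall_zero_iff, norm_smul, he, mul_one, Real.norm_of_nonneg (by positivity)]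
    exact inv_le_one_of_one_le₀ (by linarith [n.cast_nonneg (α := ℝ)])
  · intro m n hmn
    rw [Function.onFun, Set.disjoint_left]
    intro x hx hx'
    rw [Set.singleton_add, Set.mem_image] at hx hx'
    obtain ⟨y, hy, rfl⟩ := hx
    obtain ⟨z, hz, hyz⟩ := hx'
    rw [Set.mem_ofPred_eq] at hy hz
    have hP := congrArg (Submodule.span ℝ {e})ᗮ.orthogonalProjectionOnto hyz
    have hI := congrArg (fun x => ⟪e, x⟫) hyz
    simp only [map_add, map_smul, hPe, smul_zero, zero_add] at hP
    simp only [inner_add_right, real_inner_smul_right, hee, mul_one, ← hy, ← hz, hP,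
      add_left_inj, inv_inj] at hI
    exact hmn (by exact_mod_cast hI.symm)
  · exact (isClosed_eq (hg.comp (ContinuousLinearMap.continuous _))
      (continuous_const.inner continuous_id)).measurableSet

/-- The boundary of a Lipschitz domain is a null set. -/
theorem IsLipschitzDomain.volume_frontier {d : ℕ} {D : Opens (Rd d)} (hD : IsLipschitzDomain D) :
    volume (frontier (D : Set (Rd d))) = 0 := by
  refine measure_null_of_locally_null _ fun x hx => ?_
  obtain ⟨e, he, K, g, hg, U, hU, hDU⟩ := hD.boundary x hx
  refine ⟨frontier (D : Set (Rd d)) ∩ interior U, ?_,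
    measure_mono_null ?_ (volume_graph_eq_zero he hg.continuous)⟩
  · exact Filter.inter_mem self_mem_nhdsWithin
      (mem_nhdsWithin_of_mem_nhds (interior_mem_nhds.2 hU))
  · rintro y ⟨hyD, hyU⟩
    -- A boundary point is a limit of points above the graph, hence not below it; strictly above it,
    -- the point would belong to the open set `D`.
    refine le_antisymm ?_ ?_
    · have hy : y ∈ closure ((D : Set (Rd d)) ∩ interior U) :=
        isOpen_interior.closure_inter ⟨frontier_subset_closure hyD, hyU⟩
      refine closure_minimal (t := {y : Rd d |
        g ((Submodule.span ℝ {e})ᗮ.orthogonalProjectionOnto y) ≤ ⟪e, y⟫}) ?_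
        (isClosed_le (hg.continuous.comp (ContinuousLinearMap.continuous _))
          (continuous_const.inner continuous_id)) hy
      rintro z ⟨hzD, hzU⟩
      have hz : z ∈ (D : Set (Rd d)) ∩ U := ⟨hzD, interior_subset hzU⟩
      rw [hDU] at hz
      exact hz.2.le
    · by_contra! hlt
      have hy : y ∈ (D : Set (Rd d)) ∩ U := by
        rw [hDU]
        exact ⟨interior_subset hyU, hlt⟩
      rw [D.isOpen.frontier_eq] at hyD
      exact hyD.2 hy.1

/-- The elements of a Lipschitz mesh exhaust the domain up to a null set. -/
theorem IsLipschitzMesh.ae_eq_iUnion {d : ℕ} {ι : Type*} [Fintype ι] {Ω : Opens (Rd d)}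
    {T : ι → Opens (Rd d)} (hT : IsLipschitzMesh Ω T) :
    (Ω : Set (Rd d)) =ᵐ[volume] ⋃ i, (T i : Set (Rd d)) := by
  refine Filter.EventuallyLE.antisymm ?_
    (Set.iUnion_subset fun i => (hT.le i : (T i : Set (Rd d)) ⊆ Ω)).eventuallyLE
  rw [ae_le_set]
  refine measure_mono_null ?_ (measure_iUnion_null fun i => (hT.lipschitz i).volume_frontier)
  rintro x ⟨hx, hxT⟩
  have hx' := subset_closure hx
  rw [hT.cover, Set.mem_iUnion] at hx'
  obtain ⟨i, hi⟩ := hx'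
  refine Set.mem_iUnion.2 ⟨i, ?_⟩
  rw [(T i).isOpen.frontier_eq]
  exact ⟨hi, fun h => hxT (Set.mem_iUnion.2 ⟨i, h⟩)⟩

/-- The inner product of `L₂(Ω)^d` is the sum of the inner products over the elements. -/
theorem IsLipschitzMesh.inner_eq_sum {d : ℕ} {ι : Type*} [Fintype ι] {Ω : Opens (Rd d)}
    {T : ι → Opens (Rd d)} (hT : IsLipschitzMesh Ω T) (v w : L2Field Ω) :
    ⟪v, w⟫ = ∑ i, ⟪restrictL2 (hT.le i) v, restrictL2 (hT.le i) w⟫ := by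
  rw [L2.inner_def, setIntegral_congr_set hT.ae_eq_iUnion,
    integral_iUnion_fintype (fun i => (T i).isOpen.measurableSet) hT.disjoint fun i =>
      (L2.integrable_inner (𝕜 := ℝ) v w).mono_measure (Measure.restrict_mono (hT.le i) le_rfl)]
  refine Finset.sum_congr rfl fun i _ => ?_
  rw [L2.inner_def]
  refine integral_congr_ae ?_
  filter_upwards [restrictL2_coeFn (hT.le i) v, restrictL2_coeFn (hT.le i) w] with x hv hw
  rw [hv, hw]

/-- Square integrable fields on disjoint elements can be glued. -/
theorem exists_restrictL2_eq {d : ℕ} {ι : Type*} [Fintype ι] {Ω : Opens (Rd d)}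
    {T : ι → Opens (Rd d)} (hle : ∀ i, T i ≤ Ω)
    (hdisj : Pairwise fun i j => Disjoint (T i : Set (Rd d)) (T j : Set (Rd d)))
    (v : ∀ i, L2Field (T i)) : ∃ V : L2Field Ω, ∀ i, restrictL2 (hle i) V = v i := by
  have hm : MemLp (fun x => ∑ i, (T i : Set (Rd d)).indicator (v i) x) 2
      (volume.restrict (Ω : Set (Rd d))) :=
    memLp_finsetSum _ fun i _ => ((memLp_indicator_iff_restrict
      (T i).isOpen.measurableSet).2 (Lp.memLp (v i))).mono_measure Measure.restrict_le_self
  refine ⟨hm.toLp, fun i => Lp.ext ?_⟩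
  filter_upwards [restrictL2_coeFn (hle i) hm.toLp,
    ae_mono (Measure.restrict_mono (hle i) le_rfl) hm.coeFn_toLp,
    ae_restrict_mem (T i).isOpen.measurableSet] with x h1 h2 hx
  rw [h1, h2, Finset.sum_eq_single i, Set.indicator_of_mem hx]
  · intro j _ hj
    exact Set.indicator_of_notMem (fun hxj => Set.disjoint_left.1 (hdisj hj) hxj hx) _
  · simp

/-! ### Smooth compactly supported fields and integration by parts. -/

/-- A continuous compactly supported field as an element of `L₂(D)^d`. -/
noncomputable def compactFieldL2 {d : ℕ} (D : Opens (Rd d)) {ψ : Rd d → Rd d} (hc : Continuous ψ)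
    (hs : HasCompactSupport ψ) : L2Field D :=
  (hc.memLp_of_hasCompactSupport hs).toLp

theorem inner_compactFieldL2 {d : ℕ} {D : Opens (Rd d)} {ψ : Rd d → Rd d} (hc : Continuous ψ)
    (hs : HasCompactSupport ψ) (v : L2Field D) :
    ⟪v, compactFieldL2 D hc hs⟫ = ∫ x in (D : Set (Rd d)), ⟪v x, ψ x⟫ := by
  rw [L2.inner_def]
  refine integral_congr_ae ?_
  filter_upwards [(hc.memLp_of_hasCompactSupport hs).coeFn_toLp] with x hx
  rw [compactFieldL2, hx]

theorem restrictL2_compactFieldL2 {d : ℕ} {D' D : Opens (Rd d)} (h : D' ≤ D) {ψ : Rd d → Rd d}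
    (hc : Continuous ψ) (hs : HasCompactSupport ψ) :
    restrictL2 h (compactFieldL2 D hc hs) = compactFieldL2 D' hc hs := by
  refine Lp.ext ?_
  filter_upwards [restrictL2_coeFn h (compactFieldL2 D hc hs),
    ae_mono (Measure.restrict_mono h le_rfl) (hc.memLp_of_hasCompactSupport hs).coeFn_toLp,
    (hc.memLp_of_hasCompactSupport hs).coeFn_toLp] with x h1 h2 h3
  rw [h1, compactFieldL2, h2, compactFieldL2, h3]

/-- Pairings with fixed `L₂` vectors pass to `L₂` limits and split over the elements of a mesh. -/
theorem hasWeakGradDiv_iff_inner {d : ℕ} {D : Opens (Rd d)} {v g : L2Field D} :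
    HasWeakGradDiv D v g ↔ ∀ (φ : Rd d → Rd d) (hφ : IsTestField D φ),
      ⟪v, compactFieldL2 D (continuous_classicalGradDiv hφ.smooth)
        (hasCompactSupport_classicalGradDiv hφ.compact)⟫ =
      ⟪g, compactFieldL2 D hφ.smooth.continuous hφ.compact⟫ := by
  simp only [inner_compactFieldL2]
  rfl

/-- Integration by parts for a smooth field and a smooth function with compact supports. -/
theorem integral_inner_gradient_eq_neg {d : ℕ} {φ : Rd d → Rd d} {h : Rd d → ℝ}
    (hφ : ContDiff ℝ ∞ φ) (hφc : HasCompactSupport φ) (hh : ContDiff ℝ ∞ h) :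
    ∫ x, ⟪φ x, gradient h x⟫ = -∫ x, classicalDiv φ x * h x := by
  have hφi : ∀ i, ContDiff ℝ ∞ fun x => φ x i := fun i => contDiff_euclidean.1 hφ i
  have hφci : ∀ i, HasCompactSupport fun x => φ x i := fun i =>
    hφc.comp_left (g := fun y : Rd d => y i) rfl
  have hfd : ∀ i x, fderiv ℝ φ x (EuclideanSpace.single i 1) i =
      fderiv ℝ (fun y => φ y i) x (EuclideanSpace.single i 1) := by
    intro i x
    have h1 := ((EuclideanSpace.proj (𝕜 := ℝ) i).hasFDerivAt (x := φ x)).comp x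
      (hφ.differentiable (by simp) x).hasFDerivAt
    have h2 : fderiv ℝ (fun y => φ y i) x = _ := h1.fderiv
    rw [h2]
    rfl
  have hcd : ∀ {f : Rd d → ℝ}, ContDiff ℝ ∞ f → ∀ i,
      Continuous fun x => fderiv ℝ f x (EuclideanSpace.single i (1 : ℝ)) := fun hf i =>
    (hf.continuous_fderiv (by simp)).clm_apply continuous_const
  have hI1 : ∀ i, Integrable fun x =>
      φ x i * fderiv ℝ h x (EuclideanSpace.single i (1 : ℝ)) := fun i =>
    ((hφi i).continuous.mul (hcd hh i)).integrable_of_hasCompactSupport (hφci i).mul_right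
  have hI2 : ∀ i, Integrable fun x =>
      fderiv ℝ (fun y => φ y i) x (EuclideanSpace.single i (1 : ℝ)) * h x := fun i =>
    ((hcd (hφi i) i).mul hh.continuous).integrable_of_hasCompactSupport
      (((hφci i).fderiv_apply ℝ _).mul_right)
  have e1 : ∀ x, ⟪φ x, gradient h x⟫ =
      ∑ i, φ x i * fderiv ℝ h x (EuclideanSpace.single i 1) := by
    intro x
    rw [real_inner_comm, gradient, InnerProductSpace.toDual_symm_apply]
    conv_lhs => rw [← (EuclideanSpace.basisFun (Fin d) ℝ).sum_repr (φ x)]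
    simp
  simp only [e1, classicalDiv, Finset.sum_mul, hfd]
  rw [integral_finsetSum _ fun i _ => hI1 i, integral_finsetSum _ fun i _ => hI2 i,
    ← Finset.sum_neg_distrib]
  exact Finset.sum_congr rfl fun i _ => integral_mul_fderiv_eq_neg_fderiv_mul_of_integrable
    (hI2 i) (hI1 i)
    (((hφi i).continuous.mul hh.continuous).integrable_of_hasCompactSupport (hφci i).mul_right)
    (fun x _ => (hφi i).differentiable (by simp) x) (fun x _ => hh.differentiable (by simp) x)

/-- Both sides equal `-∫ div φ div ψ`. -/
theorem integral_inner_classicalGradDiv_comm {d : ℕ} {φ ψ : Rd d → Rd d}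
    (hφ : ContDiff ℝ ∞ φ) (hφc : HasCompactSupport φ)
    (hψ : ContDiff ℝ ∞ ψ) (hψc : HasCompactSupport ψ) :
    ∫ x, ⟪φ x, classicalGradDiv ψ x⟫ = ∫ x, ⟪classicalGradDiv φ x, ψ x⟫ := by
  have h1 := integral_inner_gradient_eq_neg hφ hφc (contDiff_classicalDiv hψ)
  have h2 := integral_inner_gradient_eq_neg hψ hψc (contDiff_classicalDiv hφ)
  simp only [mul_comm (classicalDiv ψ _)] at h2
  simp only [real_inner_comm, classicalGradDiv] at h1 h2 ⊢
  rw [h1, ← h2]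

/-- For smooth compactly supported fields the weak `∇ div` is the classical one. -/
theorem hasWeakGradDiv_compactFieldL2 {d : ℕ} (D : Opens (Rd d)) {φ : Rd d → Rd d}
    (hφ : ContDiff ℝ ∞ φ) (hφc : HasCompactSupport φ) :
    HasWeakGradDiv D (compactFieldL2 D hφ.continuous hφc)
      (compactFieldL2 D (continuous_classicalGradDiv hφ)
        (hasCompactSupport_classicalGradDiv hφc)) := by
  -- Only the test field has to be supported in `D`; the smooth field may cross the boundary of `D`,
  -- as a test field on `Ω` does on the elements.
  have key : ∀ {a ψ : Rd d → Rd d} (ha : Continuous a) (hac : HasCompactSupport a),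
      Function.support ψ ⊆ (D : Set (Rd d)) →
      ∫ x in (D : Set (Rd d)), ⟪compactFieldL2 D ha hac x, ψ x⟫ = ∫ x, ⟪a x, ψ x⟫ := by
    intro a ψ ha hac hψ
    calc ∫ x in (D : Set (Rd d)), ⟪compactFieldL2 D ha hac x, ψ x⟫
        = ∫ x in (D : Set (Rd d)), ⟪a x, ψ x⟫ := by
          refine integral_congr_ae ?_
          filter_upwards [(ha.memLp_of_hasCompactSupport hac).coeFn_toLp] with x hx
          rw [compactFieldL2, hx]
      _ = ∫ x, ⟪a x, ψ x⟫ := by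
          refine setIntegral_eq_integral_of_forall_compl_eq_zero fun x hx => ?_
          rw [Function.notMem_support.1 fun h => hx (hψ h), inner_zero_right]
  intro ψ hψ
  rw [key _ _ ((support_classicalGradDiv ψ).trans hψ.supp),
    key _ _ ((subset_tsupport ψ).trans hψ.supp)]
  exact integral_inner_classicalGradDiv_comm hφ hφc hψ.smooth hψ.compact

/-! ### Completeness of `H(∇div, D)`. -/

namespace HGradDiv

theorem gradDiv_eq {d : ℕ} {D : Opens (Rd d)} {v : HGradDiv D} {g : L2Field D}
    (h : HasWeakGradDiv D (field D v) g) : gradDiv D v = g :=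
  v.hasWeakGradDiv.unique h

/-- The element of `H(∇div, D)` given by a field with a weak `∇ div`. -/
def ofWeak {d : ℕ} {D : Opens (Rd d)} {v g : L2Field D} (h : HasWeakGradDiv D v g) : HGradDiv D :=
  (⟨v, g, h⟩ : hGradDivSubmodule D)

@[simp] theorem field_ofWeak {d : ℕ} {D : Opens (Rd d)} {v g : L2Field D}
    (h : HasWeakGradDiv D v g) : field D (ofWeak h) = v :=
  rfl

@[simp] theorem gradDiv_ofWeak {d : ℕ} {D : Opens (Rd d)} {v g : L2Field D}
    (h : HasWeakGradDiv D v g) : gradDiv D (ofWeak h) = g :=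
  gradDiv_eq h

theorem inner_eq {d : ℕ} {D : Opens (Rd d)} (v w : HGradDiv D) :
    ⟪v, w⟫ = ⟪field D v, field D w⟫ + ⟪gradDiv D v, gradDiv D w⟫ :=
  rfl

@[simp] theorem field_restrict {d : ℕ} {D' D : Opens (Rd d)} (h : D' ≤ D) (v : HGradDiv D) :
    field D' (restrict h v) = restrictL2 h (field D v) :=
  rfl

@[simp] theorem gradDiv_restrict {d : ℕ} {D' D : Opens (Rd d)} (h : D' ≤ D) (v : HGradDiv D) :
    gradDiv D' (restrict h v) = restrictL2 h (gradDiv D v) :=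
  gradDiv_eq (v.hasWeakGradDiv.restrict h)

/-- The space `H(∇div, D)` is complete. -/
instance {d : ℕ} (D : Opens (Rd d)) : CompleteSpace (HGradDiv D) := by
  refine Metric.complete_of_cauchySeq_tendsto fun u hu => ?_
  obtain ⟨v, hv⟩ := cauchySeq_tendsto_of_complete ((fieldL D).uniformContinuous.comp_cauchySeq hu)
  obtain ⟨g, hg⟩ := cauchySeq_tendsto_of_complete ((gradDivL D).uniformContinuous.comp_cauchySeq hu)
  -- The weak `∇div` is a closed operator: its defining identities survive `L₂` limits of the fields
  -- and of their images.
  have hw : HasWeakGradDiv D v g := hasWeakGradDiv_iff_inner.2 fun φ hφ =>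
    tendsto_nhds_unique (hv.inner tendsto_const_nhds)
      ((hg.inner tendsto_const_nhds).congr fun n =>
        (hasWeakGradDiv_iff_inner.1 (u n).hasWeakGradDiv φ hφ).symm)
  refine ⟨ofWeak hw, tendsto_iff_norm_sub_tendsto_zero.2 ?_⟩
  have h1 := tendsto_iff_norm_sub_tendsto_zero.1 hv
  have h2 := tendsto_iff_norm_sub_tendsto_zero.1 hg
  have h3 := ((h1.pow 2).add (h2.pow 2)).sqrt
  rw [zero_pow two_ne_zero, add_zero, Real.sqrt_zero] at h3
  refine h3.congr fun n => ?_
  rw [← Real.sqrt_sq (norm_nonneg (u n - ofWeak hw)), norm_sq, map_sub, map_sub, field_ofWeak,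
    gradDiv_ofWeak]
  rfl

/-- A smooth compactly supported field as an element of `H(∇div, D)`. -/
noncomputable def ofSmooth {d : ℕ} (D : Opens (Rd d)) {φ : Rd d → Rd d} (hφ : ContDiff ℝ ∞ φ)
    (hφc : HasCompactSupport φ) : HGradDiv D :=
  ofWeak (hasWeakGradDiv_compactFieldL2 D hφ hφc)

end HGradDiv

/-! ### Conformity characterised by traces. -/

/-- The trace of a field in `H(∇div, Ω)` vanishes on test fields on `Ω`. -/
theorem gradDivTrace_toBroken_ofSmooth {d : ℕ} {ι : Type*} [Fintype ι] {Ω : Opens (Rd d)}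
    {T : ι → Opens (Rd d)} (hT : IsLipschitzMesh Ω T) (w : HGradDiv Ω) {φ : Rd d → Rd d}
    (hφ : IsTestField Ω φ) :
    gradDivTrace T (toBroken hT.le w)
      (WithLp.toLp 2 fun i => HGradDiv.ofSmooth (T i) hφ.smooth hφ.compact) = 0 := by
  -- The weak identity on `Ω`, split over the elements, is the vanishing of the trace pairing.
  have h := hasWeakGradDiv_iff_inner.1 w.hasWeakGradDiv φ hφ
  rw [hT.inner_eq_sum, hT.inner_eq_sum] at h
  simp only [restrictL2_compactFieldL2] at h
  rw [gradDivTrace_apply, Finset.sum_sub_distrib, sub_eq_zero]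
  simpa [toBroken, HGradDiv.ofSmooth] using h

/-- A broken field whose trace vanishes on test fields on `Ω` belongs to `H(∇div, Ω)`. -/
theorem exists_toBroken_eq {d : ℕ} {ι : Type*} [Fintype ι] {Ω : Opens (Rd d)}
    {T : ι → Opens (Rd d)} (hT : IsLipschitzMesh Ω T) (v : BrokenHGradDiv T)
    (hv : ∀ (φ : Rd d → Rd d) (hφ : IsTestField Ω φ), gradDivTrace T v
      (WithLp.toLp 2 fun i => HGradDiv.ofSmooth (T i) hφ.smooth hφ.compact) = 0) :
    ∃ V : HGradDiv Ω, toBroken hT.le V = v := by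
  obtain ⟨V, hV⟩ := exists_restrictL2_eq hT.le hT.disjoint fun i => HGradDiv.field (T i) (v i)
  obtain ⟨G, hG⟩ := exists_restrictL2_eq hT.le hT.disjoint fun i => HGradDiv.gradDiv (T i) (v i)
  -- The same splitting read backwards: the glued `G` is the weak `∇div` of the glued `V` on all of
  -- `Ω`.
  have hw : HasWeakGradDiv Ω V G := hasWeakGradDiv_iff_inner.2 fun φ hφ => by
    have h := hv φ hφ
    rw [gradDivTrace_apply, Finset.sum_sub_distrib, sub_eq_zero] at h
    rw [hT.inner_eq_sum, hT.inner_eq_sum]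
    simp only [restrictL2_compactFieldL2, hV, hG]
    simpa [HGradDiv.ofSmooth] using h
  refine ⟨HGradDiv.ofWeak hw, ?_⟩
  ext1 i
  exact HGradDiv.field_injective (T i) (hV i)

theorem norm_toBroken {d : ℕ} {ι : Type*} [Fintype ι] {Ω : Opens (Rd d)}
    {T : ι → Opens (Rd d)} (hT : IsLipschitzMesh Ω T) (v : HGradDiv Ω) :
    ‖toBroken hT.le v‖ = ‖v‖ := by
  refine (sq_eq_sq₀ (norm_nonneg _) (norm_nonneg _)).1 ?_
  rw [← real_inner_self_eq_norm_sq, ← real_inner_self_eq_norm_sq, PiLp.inner_apply,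
    HGradDiv.inner_eq, hT.inner_eq_sum, hT.inner_eq_sum, ← Finset.sum_add_distrib]
  refine Finset.sum_congr rfl fun i _ => ?_
  rw [HGradDiv.inner_eq]
  simp [toBroken]

/-! ### The Riesz representative and the equality of norms. -/

/-- If the trace of `w ∈ H(∇div, Ω)` is represented by `τ` in the broken inner product, then
`∇ div (∇ div τ) = -τ` on every element. -/
theorem hasWeakGradDiv_gradDiv_of_inner_eq_trace {d : ℕ} {ι : Type*} [Fintype ι]
    {T : ι → Opens (Rd d)} {w τ : BrokenHGradDiv T}
    (hτ : ∀ δ, ⟪τ, δ⟫ = gradDivTrace T w δ) (i : ι) :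
    HasWeakGradDiv (T i) (HGradDiv.gradDiv (T i) (τ i)) (-HGradDiv.field (T i) (τ i)) := by
  classical
  refine hasWeakGradDiv_iff_inner.2 fun φ hφ => ?_
  have h := hτ (WithLp.toLp 2 (Pi.single i (HGradDiv.ofSmooth (T i) hφ.smooth hφ.compact)))
  rw [PiLp.inner_apply, gradDivTrace_apply, Finset.sum_eq_single i, Finset.sum_eq_single i] at h
  -- The trace side is zero by the weak identity for `w i`, leaving `(τ, φ) + (∇div τ, ∇div φ) = 0`.
  · have hw := hasWeakGradDiv_iff_inner.1 (w i).hasWeakGradDiv φ hφ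
    simp only [Pi.single_eq_same, HGradDiv.inner_eq, HGradDiv.ofSmooth, HGradDiv.field_ofWeak,
      HGradDiv.gradDiv_ofWeak] at h
    rw [inner_neg_left]
    linarith
  · intro j _ hj
    simp [Pi.single_eq_of_ne hj]
  · simp
  · intro j _ hj
    simp [Pi.single_eq_of_ne hj]
  · simp

/-- In an inner product space, `sup {⟪x, y⟫ ; ‖y‖ = 1} = ‖x‖`. -/
theorem sSup_inner_unit_sphere {E : Type*} [NormedAddCommGroup E] [InnerProductSpace ℝ E] (x : E) :
    sSup {r : ℝ | ∃ y : E, ‖y‖ = 1 ∧ r = ⟪x, y⟫} = ‖x‖ := by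
  -- The case `x = 0` includes a trivial `E`, whose unit sphere is empty; there `sSup ∅ = 0` is the
  -- right value.
  by_cases hx : x = 0
  · subst hx
    refine le_antisymm (Real.sSup_le ?_ (norm_nonneg _)) ?_
    · rintro r ⟨y, -, rfl⟩
      simp
    · rw [norm_zero]
      refine Real.sSup_nonneg ?_
      rintro r ⟨y, -, rfl⟩
      simp
  · have hx' : ‖x‖ ≠ 0 := norm_ne_zero_iff.2 hx
    refine IsGreatest.csSup_eq ⟨⟨‖x‖⁻¹ • x, ?_, ?_⟩, ?_⟩
    · rw [norm_smul, norm_inv, norm_norm, inv_mul_cancel₀ hx']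
    · rw [real_inner_smul_right, real_inner_self_eq_norm_sq]
      field_simp
    · rintro r ⟨y, hy, rfl⟩
      simpa [hy] using real_inner_le_norm x y

theorem mainTheorem10 (d : ℕ) (hd : 2 ≤ d) (Ω : TopologicalSpace.Opens (Rd d))
    (hΩ : IsLipschitzDomain Ω) (hbdd : Bornology.IsBounded (Ω : Set (Rd d)))
    (hsc : SimplyConnectedSpace Ω) {ι : Type*} [Fintype ι]
    (T : ι → TopologicalSpace.Opens (Rd d)) (hT : IsLipschitzMesh Ω T)
    (vhat : skeletonTraceSpace hT.le) :
    minimalExtensionNorm hT.le vhat = dualTraceNorm hT.le vhat := by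
  obtain ⟨w, hw⟩ : ∃ w : HGradDiv Ω, gradDivTrace T (toBroken hT.le w) = vhat.1 := vhat.2
  obtain ⟨τ, hτ⟩ : ∃ τ : BrokenHGradDiv T, ∀ δ, ⟪τ, δ⟫ = vhat.1 δ :=
    ⟨(InnerProductSpace.toDual ℝ _).symm vhat.1, fun δ => InnerProductSpace.toDual_symm_apply⟩
  have hdual : dualTraceNorm hT.le vhat = ‖τ‖ := by
    simp only [dualTraceNorm, ← hτ]
    exact sSup_inner_unit_sphere τ
  have hweak := hasWeakGradDiv_gradDiv_of_inner_eq_trace (w := toBroken hT.le w) (τ := τ)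
    fun δ => by rw [hτ, hw]
  obtain ⟨v, hvf, hvg⟩ : ∃ v : BrokenHGradDiv T,
      (∀ i, HGradDiv.field (T i) (v i) = HGradDiv.gradDiv (T i) (τ i)) ∧
      ∀ i, HGradDiv.gradDiv (T i) (v i) = -HGradDiv.field (T i) (τ i) :=
    ⟨WithLp.toLp 2 fun i => HGradDiv.ofWeak (hweak i), fun i => HGradDiv.field_ofWeak (hweak i),
      fun i => HGradDiv.gradDiv_ofWeak (hweak i)⟩
  have htrace : gradDivTrace T v = vhat.1 := by
    ext δ
    rw [← hτ, gradDivTrace_apply, PiLp.inner_apply]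
    refine Finset.sum_congr rfl fun i _ => ?_
    rw [HGradDiv.inner_eq, hvf, hvg, inner_neg_left, sub_neg_eq_add, add_comm]
  have hnorm : ‖v‖ = ‖τ‖ := by
    refine (sq_eq_sq₀ (norm_nonneg _) (norm_nonneg _)).1 ?_
    rw [PiLp.norm_sq_eq_of_L2, PiLp.norm_sq_eq_of_L2]
    refine Finset.sum_congr rfl fun i _ => ?_
    rw [HGradDiv.norm_sq, HGradDiv.norm_sq, hvf, hvg, norm_neg, add_comm]
  -- `v` has the same trace as the conforming field `w`, hence is itself conforming.
  obtain ⟨V, hV⟩ := exists_toBroken_eq hT v fun φ hφ => by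
    rw [htrace, ← hw, gradDivTrace_toBroken_ofSmooth hT w hφ]
  rw [hdual]
  refine IsLeast.csInf_eq ⟨⟨V, by rw [hV, htrace], by rw [← norm_toBroken hT, hV, hnorm]⟩, ?_⟩
  rintro r ⟨u, hu, rfl⟩
  -- Substituting `∇div τ = v` and `τ = -∇div v` turns the trace pairing of `u` with `τ` into the
  -- graph inner product of `u` and `v`.
  have h1 : ‖τ‖ * ‖τ‖ = ⟪toBroken hT.le u, v⟫ := by
    rw [← real_inner_self_eq_norm_mul_norm, hτ, ← hu, gradDivTrace_apply, PiLp.inner_apply]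
    refine Finset.sum_congr rfl fun i _ => ?_
    rw [HGradDiv.inner_eq, hvf, hvg, inner_neg_right, sub_eq_add_neg]
  have h2 := real_inner_le_norm (toBroken hT.le u) v
  rw [← h1, norm_toBroken hT, hnorm] at h2
  rcases (norm_nonneg τ).eq_or_lt with h0 | h0
  · rw [← h0]
    exact norm_nonneg u
  · exact le_of_mul_le_mul_right h2 h0
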